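/- For integers $n\ge 0$, $r\ge 1$ let $H_n^{(r)}=\sum_{j=1}^n j^{-r}$ and $H_n=H_n^{(1)}$. For $k\ge 0$ let $P_k$ and $Q_k$ be the polynomials with rational coefficients that express the elementary and the complete homogeneous symmetric functions in terms of the power sums, $e_k=P_k(p_1,\dots,p_k)$ and $h_k=Q_k(p_1,\dots,p_k)$; explicitly, $P_0=Q_0=1$ and \[ P_k(y_1,\dots,y_k)=\sum_{m_1+2m_2+\cdots+km_k=k}(-1)^{m_2+m_4+\cdots}\prod_{i=1}^k\frac1{m_i!}\Big(\frac{y_i}{i}\Big)^{m_i},\qquad Q_k(y_1,\dots,y_k)=\sum_{m_1+2m_2+\cdots+km_k=k}\ \prod_{i=1}^k\frac1{m_i!}\Big(\frac{y_i}{i}\Big)^{m_i}. \] Then for every integer $k\ge 0$ the following series converges and \[ \sum_{n=1}^\infty\frac{Q_k(H_n,H_n^{(2)},\dots,H_n^{(k)})}{n^2}=(k+1)\,\zeta(k+2), \] and for every integer $k\ge 1$ the following series converges and \[ \sum_{n=1}^\infty\frac{P_k(H_n,H_n^{(2)},\dots,H_n^{(k)})}{n^2}=\frac{k+3}{2}\,\zeta(k+2)-\frac12\sum_{j=2}^k\zeta(j)\,\zeta(k+2-j).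 \] -/

import Mathlib

/-- The generalized harmonic number `H_n^{(r)} = ∑_{j=1}^n 1 / j^r`. -/
def genHarmonic (n r : ℕ) : ℚ := ∑ j ∈ Finset.Icc 1 n, 1 / (j : ℚ) ^ r

/-- The polynomial `P_k(y_1, …, y_k)` that expresses the elementary symmetric function `e_k`
in terms of the power sums, `e_k = P_k(p_1, …, p_k)`:
`P_k = ∑_{m_1 + 2 m_2 + ⋯ = k} (-1)^{m_2 + m_4 + ⋯} ∏_i (1 / m_i!) (y_i / i)^{m_i}`.
The exponent systems `m_1 + 2 m_2 + ⋯ = k` are the partitions `π` of `k`, with `m_i` the number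
of parts of `π` equal to `i`. The variable `y_i` is `X i`; only `X 1, …, X k` occur.
In particular `P_0 = 1`. -/
noncomputable def elemPoly (k : ℕ) : MvPolynomial ℕ ℚ :=
  ∑ π : Nat.Partition k,
    (-1) ^ (∑ i ∈ (Finset.Icc 1 k).filter Even, π.parts.count i) *
      ∏ i ∈ Finset.Icc 1 k,
        MvPolynomial.C (1 / ((π.parts.count i).factorial : ℚ)) *
          (MvPolynomial.C (1 / (i : ℚ)) * MvPolynomial.X i) ^ (π.parts.count i)

/-- The polynomial `Q_k(y_1, …, y_k)` that expresses the complete symmetric function `h_k`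
in terms of the power sums, `h_k = Q_k(p_1, …, p_k)`:
`Q_k = ∑_{m_1 + 2 m_2 + ⋯ = k} ∏_i (1 / m_i!) (y_i / i)^{m_i}`, that is, `P_k` without signs. -/
noncomputable def completePoly (k : ℕ) : MvPolynomial ℕ ℚ :=
  ∑ π : Nat.Partition k,
    ∏ i ∈ Finset.Icc 1 k,
      MvPolynomial.C (1 / ((π.parts.count i).factorial : ℚ)) *
        (MvPolynomial.C (1 / (i : ℚ)) * MvPolynomial.X i) ^ (π.parts.count i)

/-- `P_k(H_n, H_n^{(2)}, …, H_n^{(k)})`. -/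
noncomputable def elemHarmonic (k n : ℕ) : ℚ :=
  MvPolynomial.eval (fun r => genHarmonic n r) (elemPoly k)

/-- `Q_k(H_n, H_n^{(2)}, …, H_n^{(k)})`. -/
noncomputable def completeHarmonic (k n : ℕ) : ℚ :=
  MvPolynomial.eval (fun r => genHarmonic n r) (completePoly k)

/-! By Newton's identities the partition sums have generating functions `∏ (1 - t/j)⁻¹` and `∏ (1 +
t/j)`, whence the recurrences in `n` `completeHarmonic_succ_succ` and `elemHarmonic_succ_succ`.

Complete case: `completeHarmonic k (n + 1) / (n + 1)` is the `t^k` coefficient of `B(1 - t, n + 1)`.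
The relation `B(a, b) = B(a, b + 1) + B(a + 1, b)` telescopes this into a sum over `m`. After the
order of summation is exchanged, the inner sum over `n` is the coefficient of `1/(m + 1 - t)²`
(`hasSum_betaCoeff_div`).

Elementary case: the recurrence splits the series into the multiple zeta values `ζ(2,1,…,1)` and
`ζ(3,1,…,1)`. Duality, proved with the connector `n! m!/(n + m)!` (`hasSum_elemHarmonic_dual`),
turns them into `ζ(k+2)` and `ζ(k+1,1)`. The latter is Euler's sum, obtained from the depth-two sum
formula and the stuffle product (`hasSum_powerHarmonic_one`). -/

open Finset Filter Topology


/-! ### Partition sums and Newton's identities -/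

/-- The contribution of a multiset of parts to the partition expansion in power sums,
with parts at most `N`. -/
def partsWeight (y : ℕ → ℚ) (N : ℕ) (s : Multiset ℕ) : ℚ :=
  ∏ i ∈ Icc 1 N, 1 / ((s.count i).factorial : ℚ) * (1 / (i : ℚ) * y i) ^ s.count i

/-- The partition expansion `∑_{π ⊢ k} ∏_i (1 / m_i!) (y_i / i)^{m_i}`. -/
def partitionSum (y : ℕ → ℚ) (k : ℕ) : ℚ := ∑ π : Nat.Partition k, partsWeight y k π.parts

theorem partsWeight_eq_of_le (y : ℕ → ℚ) {k N : ℕ} (h : k ≤ N) (π : Nat.Partition k) :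
    partsWeight y N π.parts = partsWeight y k π.parts := by
  unfold partsWeight
  symm
  apply Finset.prod_subset (Icc_subset_Icc_right h)
  intro i _ hi
  have : i ∉ π.parts := fun hm => hi (mem_Icc.2 ⟨π.parts_pos hm, π.le_of_mem_parts hm⟩)
  simp [Multiset.count_eq_zero_of_notMem this]

theorem partsWeight_cons (y : ℕ → ℚ) {N i : ℕ} (h1 : 1 ≤ i) (hN : i ≤ N) (s : Multiset ℕ) :
    ((i ::ₘ s).count i : ℚ) * i * partsWeight y N (i ::ₘ s) = y i * partsWeight y N s := by
  unfold partsWeight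
  have hi : i ∈ Icc 1 N := mem_Icc.2 ⟨h1, hN⟩
  rw [← mul_prod_erase _ _ hi, ← mul_prod_erase (Icc 1 N) (fun j => 1 / ((s.count j).factorial : ℚ) *
    (1 / (j : ℚ) * y j) ^ s.count j) hi]
  have : ∏ j ∈ (Icc 1 N).erase i, 1 / (((i ::ₘ s).count j).factorial : ℚ) *
      (1 / (j : ℚ) * y j) ^ (i ::ₘ s).count j = ∏ j ∈ (Icc 1 N).erase i,
      1 / ((s.count j).factorial : ℚ) * (1 / (j : ℚ) * y j) ^ s.count j := by
    apply prod_congr rfl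
    intro j hj
    rw [Multiset.count_cons_of_ne (ne_of_mem_erase hj)]
  rw [this, Multiset.count_cons_self, Nat.factorial_succ, pow_succ]
  have h0 : (i : ℚ) ≠ 0 := by positivity
  have h2 : ((s.count i).factorial : ℚ) ≠ 0 := by positivity
  push_cast
  field_simp

/-- Adjoining a part `i` is a bijection from partitions of `k - i` to partitions of `k` containing
`i`; the others have count zero. -/
theorem sum_count_mul_partsWeight (y : ℕ → ℚ) {k i : ℕ} (h1 : 1 ≤ i) (hk : i ≤ k) :
    ∑ π : Nat.Partition k, (π.parts.count i : ℚ) * i * partsWeight y k π.parts =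
      y i * partitionSum y (k - i) := by
  unfold partitionSum
  rw [mul_sum]
  symm
  let e : Nat.Partition (k - i) → Nat.Partition k := fun π =>
    { parts := i ::ₘ π.parts
      parts_pos := by
        intro j hj
        rcases Multiset.mem_cons.1 hj with rfl | hj
        · exact h1
        · exact π.parts_pos hj
      parts_sum := by rw [Multiset.sum_cons, π.parts_sum]; omega }
  apply Finset.sum_of_injOn e
  · intro a _ b _ hab
    have : i ::ₘ a.parts = i ::ₘ b.parts := congrArg Nat.Partition.parts hab
    exact Nat.Partition.ext ((Multiset.cons_inj_right i).1 this)
  · intro a _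
    simp
  · intro π _ hπ
    have : i ∉ π.parts := by
      intro hm
      apply hπ
      have hs : i + (π.parts.erase i).sum = k := by
        rw [Multiset.sum_erase hm, π.parts_sum]
      refine ⟨⟨π.parts.erase i, fun hj => π.parts_pos (Multiset.mem_of_mem_erase hj),
        by omega⟩, by simp, ?_⟩
      exact Nat.Partition.ext (Multiset.cons_erase hm)
    simp [Multiset.count_eq_zero_of_notMem this]
  · intro π _
    rw [← partsWeight_eq_of_le y (Nat.sub_le k i) π]
    exact (partsWeight_cons y h1 hk π.parts).symm

/-- Newton's identity: weight each partition by its size, written as `∑ i * m_i`. -/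
theorem partitionSum_succ (y : ℕ → ℚ) (k : ℕ) :
    ((k : ℚ) + 1) * partitionSum y (k + 1) =
      ∑ i ∈ range (k + 1), y (i + 1) * partitionSum y (k - i) := by
  have hs : ∀ π : Nat.Partition (k + 1),
      ((k : ℚ) + 1) = ∑ i ∈ Icc 1 (k + 1), (π.parts.count i : ℚ) * i := by
    intro π
    have h := Finset.sum_multiset_count_of_subset π.parts (Icc 1 (k + 1)) (by
      intro j hj
      rw [Multiset.mem_toFinset] at hj
      exact mem_Icc.2 ⟨π.parts_pos hj, π.le_of_mem_parts hj⟩)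
    rw [π.parts_sum] at h
    have h' := congrArg (Nat.cast (R := ℚ)) h
    push_cast at h'
    simpa using h'
  have : ((k : ℚ) + 1) * partitionSum y (k + 1) = ∑ i ∈ Icc 1 (k + 1),
      ∑ π : Nat.Partition (k + 1), (π.parts.count i : ℚ) * i * partsWeight y (k + 1) π.parts := by
    rw [sum_comm]
    unfold partitionSum
    rw [mul_sum]
    refine sum_congr rfl fun π _ => ?_
    rw [← sum_mul, ← hs π]
  have h2 := Finset.sum_Ico_add' (fun i => y i * partitionSum y (k + 1 - i)) 0 (k + 1) 1
  simp only [Nat.add_sub_add_right] at h2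
  rw [this, Finset.range_eq_Ico, h2]
  refine sum_congr rfl fun i hi => ?_
  rw [mem_Ico] at hi
  exact sum_count_mul_partsWeight y (by omega) (by omega)

theorem partitionSum_zero (y : ℕ → ℚ) : partitionSum y 0 = 1 := by
  simp [partitionSum, partsWeight]

theorem completeHarmonic_eq_partitionSum (k n : ℕ) :
    completeHarmonic k n = partitionSum (fun r => genHarmonic n r) k := by
  simp [completeHarmonic, completePoly, partitionSum, partsWeight]

/-- The sign is absorbed by `y_i ↦ (-1)^(i+1) y_i`, so one theory serves both families. -/
theorem elemHarmonic_eq_partitionSum (k n : ℕ) :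
    elemHarmonic k n = partitionSum (fun r => (-1) ^ (r + 1) * genHarmonic n r) k := by
  simp only [elemHarmonic, elemPoly, partitionSum, partsWeight, map_sum, map_mul, map_prod, map_pow,
    map_neg, map_one, MvPolynomial.eval_C, MvPolynomial.eval_X]
  refine sum_congr rfl fun π _ => ?_
  rw [← prod_pow_eq_pow_sum, prod_filter, ← prod_mul_distrib]
  refine prod_congr rfl fun i _ => ?_
  split_ifs with h
  · rw [h.add_one.neg_one_pow]
    rw [mul_left_comm, ← mul_pow]
    ring
  · rw [(Nat.not_even_iff_odd.1 h).add_one.neg_one_pow]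
    ring

/-! ### Generating functions and recurrences in `n` -/

open PowerSeries in
theorem derivative_mk_partitionSum (y : ℕ → ℚ) :
    PowerSeries.derivative ℚ (PowerSeries.mk (partitionSum y)) =
      PowerSeries.mk (fun i => y (i + 1)) * PowerSeries.mk (partitionSum y) := by
  ext k
  rw [PowerSeries.coeff_derivative, PowerSeries.coeff_mul, coeff_mk,
    Finset.Nat.sum_antidiagonal_eq_sum_range_succ_mk, mul_comm, partitionSum_succ]
  simp

theorem eq_of_derivative_eq_mul {f g L : PowerSeries ℚ} (hf : PowerSeries.derivative ℚ f = L * f)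
    (hg : PowerSeries.derivative ℚ g = L * g)
    (h : PowerSeries.coeff 0 f = PowerSeries.coeff 0 g) : f = g := by
  ext n
  induction n using Nat.strong_induction_on with
  | _ n ih =>
    cases n with
    | zero => exact h
    | succ n =>
      have h1 := congrArg (PowerSeries.coeff n) hf
      have h2 := congrArg (PowerSeries.coeff n) hg
      rw [PowerSeries.coeff_derivative, PowerSeries.coeff_mul] at h1 h2
      have h3 : PowerSeries.coeff (n + 1) f * ((n : ℚ) + 1) =
          PowerSeries.coeff (n + 1) g * ((n : ℚ) + 1) := by
        rw [h1, h2]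
        refine sum_congr rfl fun p hp => ?_
        rw [ih p.2 (by have := mem_antidiagonal.1 hp; omega)]
      exact mul_right_cancel₀ (by positivity) h3

theorem genHarmonic_succ (n r : ℕ) :
    genHarmonic (n + 1) r = genHarmonic n r + (1 / ((n : ℚ) + 1)) ^ r := by
  unfold genHarmonic
  rw [sum_Icc_succ_top (by omega)]
  push_cast
  rw [one_div_pow]

theorem genHarmonic_zero (r : ℕ) : genHarmonic 0 r = 0 := by simp [genHarmonic]

theorem one_sub_mul_mk_geometric {K : Type*} [Field K] (x : K) :
    (1 - PowerSeries.C x * PowerSeries.X) * PowerSeries.mk (fun i => x ^ (i + 1)) =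
      PowerSeries.C x := by
  ext n
  cases n with
  | zero => simp
  | succ n => 
    simp only [sub_mul, one_mul, mul_assoc, map_sub, PowerSeries.coeff_C_mul,
      PowerSeries.coeff_succ_X_mul, PowerSeries.coeff_mk, PowerSeries.coeff_C]
    simp [pow_succ']

theorem completeHarmonic_zero_left (n : ℕ) : completeHarmonic 0 n = 1 := by
  rw [completeHarmonic_eq_partitionSum, partitionSum_zero]

theorem elemHarmonic_zero_left (n : ℕ) : elemHarmonic 0 n = 1 := by
  rw [elemHarmonic_eq_partitionSum, partitionSum_zero]

theorem completeHarmonic_succ_zero (k : ℕ) : completeHarmonic (k + 1) 0 = 0 := by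
  have h := partitionSum_succ (fun r => genHarmonic 0 r) k
  simp only [genHarmonic_zero, zero_mul, sum_const_zero] at h
  rw [completeHarmonic_eq_partitionSum]
  simp only [genHarmonic_zero]
  exact (mul_eq_zero.1 h).resolve_left (by positivity)

theorem elemHarmonic_succ_zero (k : ℕ) : elemHarmonic (k + 1) 0 = 0 := by
  have h := partitionSum_succ (fun r => (-1) ^ (r + 1) * genHarmonic 0 r) k
  simp only [genHarmonic_zero, zero_mul, mul_zero, sum_const_zero] at h
  rw [elemHarmonic_eq_partitionSum]
  simp only [genHarmonic_zero, mul_zero]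
  exact (mul_eq_zero.1 h).resolve_left (by positivity)

/-- With `F_n = ∏_{j ≤ n} (1 - t/j)⁻¹`, the series `(1 - x t) F_{n+1}` and `F_n` solve the same
linear differential equation with the same constant term. -/
theorem completeHarmonic_succ_succ (k n : ℕ) : completeHarmonic (k + 1) (n + 1) =
    completeHarmonic (k + 1) n + 1 / ((n : ℚ) + 1) * completeHarmonic k (n + 1) := by
  set x : ℚ := 1 / ((n : ℚ) + 1) with hx
  have hL : (1 - PowerSeries.C x * PowerSeries.X) *
      PowerSeries.mk (fun i => genHarmonic (n + 1) (i + 1)) =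
      (1 - PowerSeries.C x * PowerSeries.X) * PowerSeries.mk (fun i => genHarmonic n (i + 1)) +
        PowerSeries.C x := by
    have h3 : PowerSeries.mk (fun i => genHarmonic (n + 1) (i + 1)) =
        PowerSeries.mk (fun i => genHarmonic n (i + 1)) + PowerSeries.mk (fun i => x ^ (i + 1)) := by
      ext i
      simp [genHarmonic_succ, hx]
    rw [h3]
    linear_combination one_sub_mul_mk_geometric x
  have h1 := derivative_mk_partitionSum (fun r => genHarmonic (n + 1) r)
  have h2 := derivative_mk_partitionSum (fun r => genHarmonic n r)
  have key := eq_of_derivative_eq_mul (f := (1 - PowerSeries.C x * PowerSeries.X) *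
    PowerSeries.mk (partitionSum fun r => genHarmonic (n + 1) r)) (L := _) ?_ h2 ?_
  · have := congrArg (PowerSeries.coeff (k + 1)) key
    simp only [sub_mul, one_mul, mul_assoc, map_sub, PowerSeries.coeff_C_mul,
      PowerSeries.coeff_succ_X_mul, PowerSeries.coeff_mk] at this
    simp only [completeHarmonic_eq_partitionSum]
    linarith
  · rw [Derivation.leibniz, h1]
    simp only [smul_eq_mul, map_sub, Derivation.leibniz, PowerSeries.derivative_C,
      PowerSeries.derivative_X, Derivation.map_one_eq_zero]
    linear_combination (PowerSeries.mk (partitionSum fun r => genHarmonic (n + 1) r)) * hL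
  · simp [sub_mul, mul_assoc, partitionSum_zero]

theorem elemHarmonic_succ_succ (k n : ℕ) : elemHarmonic (k + 1) (n + 1) =
    elemHarmonic (k + 1) n + 1 / ((n : ℚ) + 1) * elemHarmonic k n := by
  set x : ℚ := 1 / ((n : ℚ) + 1) with hx
  have hL : (1 + PowerSeries.C x * PowerSeries.X) *
      PowerSeries.mk (fun i => (-1) ^ (i + 1 + 1) * genHarmonic (n + 1) (i + 1)) =
      (1 + PowerSeries.C x * PowerSeries.X) *
        PowerSeries.mk (fun i => (-1) ^ (i + 1 + 1) * genHarmonic n (i + 1)) +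
        PowerSeries.C x := by
    have := one_sub_mul_mk_geometric (-x)
    have h3 : PowerSeries.mk (fun i => (-1) ^ (i + 1 + 1) * genHarmonic (n + 1) (i + 1)) =
        PowerSeries.mk (fun i => (-1) ^ (i + 1 + 1) * genHarmonic n (i + 1)) -
        PowerSeries.mk (fun i => (-x) ^ (i + 1)) := by
      ext i
      simp only [genHarmonic_succ, map_sub, PowerSeries.coeff_mk, ← hx]
      rw [neg_pow x]
      ring
    rw [h3]
    rw [map_neg] at this
    linear_combination -this
  have h1 := derivative_mk_partitionSum (fun r => (-1) ^ (r + 1) * genHarmonic (n + 1) r)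
  have h2 := derivative_mk_partitionSum (fun r => (-1) ^ (r + 1) * genHarmonic n r)
  have key := eq_of_derivative_eq_mul (f := (1 + PowerSeries.C x * PowerSeries.X) *
    PowerSeries.mk (partitionSum fun r => (-1) ^ (r + 1) * genHarmonic n r)) (L := _) ?_ h1 ?_
  · have := congrArg (PowerSeries.coeff (k + 1)) key
    simp only [add_mul, one_mul, mul_assoc, map_add, PowerSeries.coeff_C_mul,
      PowerSeries.coeff_succ_X_mul, PowerSeries.coeff_mk] at this
    simp only [elemHarmonic_eq_partitionSum]
    linarith
  · rw [Derivation.leibniz, h2]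
    simp only [smul_eq_mul, map_add, Derivation.leibniz, PowerSeries.derivative_C,
      PowerSeries.derivative_X, Derivation.map_one_eq_zero]
    linear_combination
      -(PowerSeries.mk (partitionSum fun r => (-1) ^ (r + 1) * genHarmonic n r)) * hL
  · simp [add_mul, mul_assoc, partitionSum_zero]


/-! ### Exchange of summation, telescoping, real zeta values -/

theorem hasSum_of_eq {f g : ℕ → ℝ} {a b : ℝ} (h : HasSum f a) (hg : ∀ n, g n = f n)
    (hb : b = a) : HasSum g b := by
  rw [hb, funext hg]
  exact h

theorem hasSum_swap_of_nonneg {F : ℕ → ℕ → ℝ} (hF : ∀ m n, 0 ≤ F m n) {a b : ℕ → ℝ} {A : ℝ}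
    (ha : ∀ m, HasSum (F m) (a m)) (hb : ∀ n, HasSum (fun m => F m n) (b n)) (hA : HasSum a A) :
    HasSum b A := by
  have hs : Summable (fun p : ℕ × ℕ => F p.1 p.2) := by
    rw [summable_prod_of_nonneg (fun p => hF p.1 p.2)]
    refine ⟨fun m => (ha m).summable, ?_⟩
    simpa only [(ha _).tsum_eq] using hA.summable
  have h1 : A = ∑' p : ℕ × ℕ, F p.1 p.2 := hA.unique (hs.hasSum.prod_fiberwise ha)
  have h2 : HasSum (fun p : ℕ × ℕ => F p.2 p.1) A := by
    rw [h1]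
    exact (Equiv.prodComm ℕ ℕ).hasSum_iff.2 hs.hasSum
  exact h2.prod_fiberwise hb

theorem hasSum_sum_range_of_nonneg {f : ℕ → ℕ → ℝ} (hf : ∀ a b, 0 ≤ f a b) {g : ℕ → ℝ} {A : ℝ}
    (hg : ∀ b, HasSum (fun c => f (b + 1 + c) b) (g b)) (hA : HasSum g A) :
    HasSum (fun a => ∑ b ∈ range a, f a b) A := by
  refine hasSum_swap_of_nonneg (F := fun b a => if b < a then f a b else 0) ?_ (fun b => ?_)
    (fun a => ?_) hA
  · intro b a
    split_ifs
    exacts [hf _ _, le_rfl]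
  · rw [← hasSum_nat_add_iff' (b + 1), Finset.sum_eq_zero, sub_zero]
    · refine hasSum_of_eq (hg b) (fun c => ?_) rfl
      rw [if_pos (by omega), add_comm c]
    · intro i hi
      rw [mem_range] at hi
      rw [if_neg (by omega)]
  · have := hasSum_sum_of_ne_finset_zero (f := fun b => if b < a then f a b else 0)
      (L := SummationFilter.unconditional ℕ) (s := range a) (by intro b hb; rw [mem_range] at hb; exact if_neg hb)
    convert this using 1
    refine sum_congr rfl fun b hb => ?_
    rw [if_pos (mem_range.1 hb)]

theorem hasSum_of_telescoping {f g : ℕ → ℝ} (hf : ∀ n, 0 ≤ f n) (h : ∀ n, f n = g n - g (n + 1))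
    (hg : Tendsto g atTop (𝓝 0)) : HasSum f (g 0) := by
  rw [hasSum_iff_tendsto_nat_of_nonneg hf]
  have : ∀ n, ∑ i ∈ range n, f i = g 0 - g n := by
    intro n
    simp only [h]
    exact sum_range_sub' g n
  simp only [this]
  simpa using hg.const_sub (g 0)

/-- The real number `ζ(s)`, as a series over positive integers. -/
noncomputable def realZeta (s : ℕ) : ℝ := ∑' n : ℕ, 1 / ((n : ℝ) + 1) ^ s

theorem hasSum_realZeta {s : ℕ} (hs : 2 ≤ s) :
    HasSum (fun n : ℕ => 1 / ((n : ℝ) + 1) ^ s) (realZeta s) := by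
  apply Summable.hasSum
  have := (summable_nat_add_iff 1).2 (Real.summable_one_div_nat_pow.2 (show 1 < s by omega))
  simpa using this

theorem riemannZeta_eq_realZeta {s : ℕ} (hs : 2 ≤ s) : riemannZeta (s : ℂ) = (realZeta s : ℂ) := by
  rw [zeta_nat_eq_tsum_of_gt_one (by omega)]
  have h1 : HasSum (fun n : ℕ => 1 / ((n : ℂ) + 1) ^ s) (realZeta s : ℂ) := by
    have := Complex.hasSum_ofReal.2 (hasSum_realZeta hs)
    push_cast at this
    exact this
  have h2 : HasSum (fun n : ℕ => 1 / (n : ℂ) ^ s) (realZeta s : ℂ) := by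
    rw [← hasSum_nat_add_iff' 1]
    simpa [show s ≠ 0 by omega] using h1
  exact h2.tsum_eq

/-! ### Beta coefficients and the complete sum -/

/-- The power series in `t` of the Beta function `B(m + 1 - t, n + 1)`. -/
noncomputable def betaSeries (m n : ℕ) : PowerSeries ℝ :=
  PowerSeries.C (n.factorial : ℝ) *
    ∏ j ∈ range (n + 1), PowerSeries.mk (fun k => (1 / ((m : ℝ) + 1 + j)) ^ (k + 1))

noncomputable def betaCoeff (k m n : ℕ) : ℝ := PowerSeries.coeff k (betaSeries m n)

theorem C_sub_X_mul_mk {c : ℝ} (hc : c ≠ 0) :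
    (PowerSeries.C c - PowerSeries.X) * PowerSeries.mk (fun k => (1 / c) ^ (k + 1)) = 1 := by
  ext n
  cases n with
  | zero => simp [hc]
  | succ n =>
    simp only [sub_mul, map_sub, PowerSeries.coeff_C_mul, PowerSeries.coeff_succ_X_mul,
      PowerSeries.coeff_mk, PowerSeries.coeff_one]
    rw [if_neg (by omega), pow_succ _ (n + 1)]
    field_simp
    simp

theorem betaSeries_right (m n : ℕ) : (PowerSeries.C ((m : ℝ) + n + 2) - PowerSeries.X) *
    betaSeries m (n + 1) = PowerSeries.C ((n : ℝ) + 1) * betaSeries m n := by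
  unfold betaSeries
  rw [prod_range_succ _ (n + 1), Nat.factorial_succ]
  have h := C_sub_X_mul_mk (c := (m : ℝ) + 1 + (n + 1 : ℕ)) (by positivity)
  have h2 : (m : ℝ) + n + 2 = (m : ℝ) + 1 + (n + 1 : ℕ) := by push_cast; ring
  rw [h2]
  push_cast at h ⊢
  rw [map_mul]
  linear_combination (PowerSeries.C ((n : ℝ) + 1) * PowerSeries.C (n.factorial : ℝ) *
    ∏ j ∈ range (n + 1), PowerSeries.mk (fun k => (1 / ((m : ℝ) + 1 + j)) ^ (k + 1))) * h

theorem betaSeries_left (m n : ℕ) : (PowerSeries.C ((m : ℝ) + 1) - PowerSeries.X) *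
    betaSeries m (n + 1) = PowerSeries.C ((n : ℝ) + 1) * betaSeries (m + 1) n := by
  unfold betaSeries
  rw [prod_range_succ', Nat.factorial_succ]
  have h := C_sub_X_mul_mk (c := (m : ℝ) + 1) (by positivity)
  have h3 : ∀ j : ℕ, (m : ℝ) + 1 + (j + 1 : ℕ) = (m + 1 : ℕ) + 1 + j := by
    intro j; push_cast; ring
  simp only [h3]
  push_cast at h ⊢
  rw [map_mul, add_zero]
  linear_combination (PowerSeries.C ((n : ℝ) + 1) * PowerSeries.C (n.factorial : ℝ) *
    ∏ j ∈ range (n + 1), PowerSeries.mk (fun k => (1 / ((m : ℝ) + 1 + 1 + j)) ^ (k + 1))) * h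

/-- Coefficient form of `B(a, b) = B(a, b + 1) + B(a + 1, b)`; it drives the telescoping in both `m`
and `n`. -/
theorem betaCoeff_eq_add (k m n : ℕ) :
    betaCoeff k m n = betaCoeff k m (n + 1) + betaCoeff k (m + 1) n := by
  have h : PowerSeries.C ((n : ℝ) + 1) * betaSeries m n =
      PowerSeries.C ((n : ℝ) + 1) * (betaSeries m (n + 1) + betaSeries (m + 1) n) := by
    have h1 := betaSeries_right m n
    have h2 := betaSeries_left m n
    have h3 : PowerSeries.C ((m : ℝ) + n + 2) =
      PowerSeries.C ((m : ℝ) + 1) + PowerSeries.C ((n : ℝ) + 1) := by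
      rw [← map_add]; congr 1; ring
    rw [h3] at h1
    linear_combination h2 - h1
  have h4 := congrArg (PowerSeries.coeff k) h
  rw [PowerSeries.coeff_C_mul, PowerSeries.coeff_C_mul, map_add] at h4
  exact mul_left_cancel₀ (by positivity) h4

theorem coeff_prod_nonneg {ι : Type*} (s : Finset ι) (f : ι → PowerSeries ℝ)
    (hf : ∀ i ∈ s, ∀ k, 0 ≤ PowerSeries.coeff k (f i)) (k : ℕ) :
    0 ≤ PowerSeries.coeff k (∏ i ∈ s, f i) := by
  classical
  rw [PowerSeries.coeff_prod]
  exact sum_nonneg fun l _ => prod_nonneg fun i hi => hf i hi _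

theorem betaCoeff_nonneg (k m n : ℕ) : 0 ≤ betaCoeff k m n := by
  unfold betaCoeff betaSeries
  rw [PowerSeries.coeff_C_mul]
  refine mul_nonneg (by positivity) (coeff_prod_nonneg _ _ ?_ _)
  intro i _ k
  rw [PowerSeries.coeff_mk]
  positivity

theorem betaCoeff_zero_left (m n : ℕ) :
    ((m : ℝ) + 1) * betaCoeff 0 m (n + 1) = ((n : ℝ) + 1) * betaCoeff 0 (m + 1) n := by
  have := congrArg (PowerSeries.coeff 0) (betaSeries_left m n)
  rw [sub_mul, map_sub, PowerSeries.coeff_C_mul, PowerSeries.coeff_C_mul,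
    PowerSeries.coeff_zero_X_mul, sub_zero] at this
  exact this

theorem betaCoeff_succ_left (k m n : ℕ) :
    ((m : ℝ) + 1) * betaCoeff (k + 1) m (n + 1) - betaCoeff k m (n + 1) =
      ((n : ℝ) + 1) * betaCoeff (k + 1) (m + 1) n := by
  have := congrArg (PowerSeries.coeff (k + 1)) (betaSeries_left m n)
  rw [sub_mul, map_sub, PowerSeries.coeff_C_mul, PowerSeries.coeff_C_mul,
    PowerSeries.coeff_succ_X_mul] at this
  exact this

theorem betaCoeff_index_zero (k m : ℕ) : betaCoeff k m 0 = 1 / ((m : ℝ) + 1) ^ (k + 1) := by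
  simp [betaCoeff, betaSeries]

theorem betaCoeff_first (k n : ℕ) :
    betaCoeff k 0 n = (completeHarmonic k (n + 1) : ℝ) / ((n : ℝ) + 1) := by
  induction k generalizing n with
  | zero =>
    rw [completeHarmonic_zero_left]
    induction n with
    | zero => simp [betaCoeff_index_zero]
    | succ n ih =>
      have := congrArg (PowerSeries.coeff 0) (betaSeries_right 0 n)
      rw [sub_mul, map_sub, PowerSeries.coeff_C_mul, PowerSeries.coeff_C_mul,
        PowerSeries.coeff_zero_X_mul, sub_zero] at this
      change _ * betaCoeff 0 0 (n + 1) = _ * betaCoeff 0 0 n at this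
      rw [ih] at this
      have h1 : ((n : ℝ) + 1) ≠ 0 := by positivity
      have h2 : ((n : ℝ) + 1 + 1) ≠ 0 := by positivity
      push_cast at this ⊢
      field_simp at this ⊢
      linarith
  | succ k ihk =>
    induction n with
    | zero =>
      rw [betaCoeff_index_zero, completeHarmonic_succ_succ, completeHarmonic_succ_zero]
      have h := ihk 0
      rw [betaCoeff_index_zero] at h
      push_cast at h ⊢
      simp at h ⊢
      exact h
    | succ n ih =>
      have := congrArg (PowerSeries.coeff (k + 1)) (betaSeries_right 0 n)
      rw [sub_mul, map_sub, PowerSeries.coeff_C_mul, PowerSeries.coeff_C_mul,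
        PowerSeries.coeff_succ_X_mul] at this
      change _ * betaCoeff (k + 1) 0 (n + 1) - betaCoeff k 0 (n + 1) =
        _ * betaCoeff (k + 1) 0 n at this
      rw [ih, ihk] at this
      have h1 : ((n : ℝ) + 1) ≠ 0 := by positivity
      have h2 : ((n : ℝ) + 1 + 1) ≠ 0 := by positivity
      rw [completeHarmonic_succ_succ k (n + 1)]
      push_cast at this ⊢
      field_simp at this ⊢
      linarith

theorem harmonic_cast_nonneg (n : ℕ) : (0 : ℚ) ≤ harmonic n := by
  unfold harmonic
  exact sum_nonneg fun i _ => by positivity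

/-- A crude bound `h_k ≤ h_1^k`: logarithmic growth suffices for the telescoping boundary terms to
vanish. -/
theorem completeHarmonic_le_harmonic_pow (k n : ℕ) : completeHarmonic k n ≤ harmonic n ^ k := by
  induction k generalizing n with
  | zero => simp [completeHarmonic_zero_left]
  | succ k ihk =>
    induction n with
    | zero => simp [completeHarmonic_succ_zero]
    | succ n ih =>
      rw [completeHarmonic_succ_succ]
      have h1 := ihk (n + 1)
      have h2 : harmonic n ≤ harmonic (n + 1) := by
        rw [harmonic_succ]
        have : (0 : ℚ) ≤ ((n + 1 : ℕ) : ℚ)⁻¹ := by positivity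
        linarith
      have h0 := harmonic_cast_nonneg n
      have h3 : harmonic n ^ k ≤ harmonic (n + 1) ^ k := pow_le_pow_left₀ h0 h2 k
      calc completeHarmonic (k + 1) n + 1 / ((n : ℚ) + 1) * completeHarmonic k (n + 1)
          ≤ harmonic n ^ k * harmonic n + 1 / ((n : ℚ) + 1) * harmonic (n + 1) ^ k := by
            rw [← pow_succ]; gcongr
        _ ≤ harmonic (n + 1) ^ k * harmonic n + 1 / ((n : ℚ) + 1) * harmonic (n + 1) ^ k := by
            gcongr
        _ = harmonic (n + 1) ^ (k + 1) := by
            rw [pow_succ, harmonic_succ n]; push_cast; rw [one_div]; ring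

theorem tendsto_one_add_log_pow_div (k : ℕ) :
    Tendsto (fun n : ℕ => (1 + Real.log ((n : ℝ) + 1)) ^ k / ((n : ℝ) + 1)) atTop (𝓝 0) := by
  have h := (Real.isLittleO_pow_log_id_atTop (n := k)).tendsto_div_nhds_zero
  -- The argument `e (n + 1)` has logarithm exactly `1 + log (n + 1)`.
  have h2 : Tendsto (fun n : ℕ => Real.exp 1 * ((n : ℝ) + 1)) atTop atTop :=
    ((tendsto_natCast_atTop_atTop (R := ℝ)).atTop_add tendsto_const_nhds).const_mul_atTop
      (Real.exp_pos 1)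
  have h3 := (h.comp h2).const_mul (Real.exp 1)
  rw [mul_zero] at h3
  refine h3.congr fun n => ?_
  have h4 : ((n : ℝ) + 1) ≠ 0 := by positivity
  simp only [Function.comp, id]
  rw [Real.log_mul (Real.exp_ne_zero 1) h4, Real.log_exp]
  field_simp

theorem tendsto_betaCoeff_right (k m : ℕ) : Tendsto (fun n => betaCoeff k m n) atTop (𝓝 0) := by
  induction m with
  | zero =>
    refine squeeze_zero (fun n => betaCoeff_nonneg k 0 n) (fun n => ?_)
      (tendsto_one_add_log_pow_div k)
    rw [betaCoeff_first]
    gcongr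
    have h1 : (completeHarmonic k (n + 1) : ℝ) ≤ (harmonic (n + 1) : ℝ) ^ k := by
      exact_mod_cast completeHarmonic_le_harmonic_pow k (n + 1)
    have h2 := harmonic_le_one_add_log (n + 1)
    push_cast at h2
    exact h1.trans (pow_le_pow_left₀ (by exact_mod_cast harmonic_cast_nonneg _) h2 k)
  | succ m ih =>
    refine squeeze_zero (fun n => betaCoeff_nonneg k _ n) (fun n => ?_) ih
    rw [betaCoeff_eq_add k m n]
    linarith [betaCoeff_nonneg k m (n + 1)]

theorem tendsto_betaCoeff_left (k n : ℕ) : Tendsto (fun m => betaCoeff k m n) atTop (𝓝 0) := by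
  induction n with
  | zero =>
    simp only [betaCoeff_index_zero]
    refine squeeze_zero (fun m => by positivity) (fun m => ?_)
      (tendsto_one_div_add_atTop_nhds_zero_nat (𝕜 := ℝ))
    apply one_div_le_one_div_of_le (by positivity)
    exact le_self_pow₀ (by linarith [Nat.cast_nonneg (α := ℝ) m]) (by omega)
  | succ n ih =>
    refine squeeze_zero (fun m => betaCoeff_nonneg k m _) (fun m => ?_) ih
    rw [betaCoeff_eq_add k m n]
    linarith [betaCoeff_nonneg k (m + 1) n]

theorem hasSum_betaCoeff_succ_left (k m : ℕ) :
    HasSum (fun n => betaCoeff k (m + 1) n) (1 / ((m : ℝ) + 1) ^ (k + 1)) := by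
  rw [← betaCoeff_index_zero]
  exact hasSum_of_telescoping (g := fun n => betaCoeff k m n) (fun n => betaCoeff_nonneg k _ n)
    (fun n => by rw [betaCoeff_eq_add k m n]; ring) (tendsto_betaCoeff_right k m)

/-- With `a = m + 1 - t` this says `∑ B(a, n + 2)/(n + 1) = 1/a²`: each term is `B(a + 1, n + 1)/a`,
and `∑ B(a + 1, n + 1) = B(a, 1) = 1/a`. Division by `a` becomes the induction on `k`. -/
theorem hasSum_betaCoeff_div (k m : ℕ) :
    HasSum (fun n : ℕ => betaCoeff k m (n + 1) / ((n : ℝ) + 1))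
      (((k : ℝ) + 1) / ((m : ℝ) + 1) ^ (k + 2)) := by
  have hm : ((m : ℝ) + 1) ≠ 0 := by positivity
  induction k with
  | zero =>
    refine hasSum_of_eq ((hasSum_betaCoeff_succ_left 0 m).mul_left (1 / ((m : ℝ) + 1)))
      (fun n => ?_) ?_
    · have := betaCoeff_zero_left m n
      have h1 : ((n : ℝ) + 1) ≠ 0 := by positivity
      field_simp
      linarith
    · push_cast
      field_simp
      ring
  | succ k ih =>
    refine hasSum_of_eq (((hasSum_betaCoeff_succ_left (k + 1) m).add ih).mul_left
      (1 / ((m : ℝ) + 1))) (fun n => ?_) ?_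
    · have := betaCoeff_succ_left k m n
      have h1 : ((n : ℝ) + 1) ≠ 0 := by positivity
      field_simp
      linarith
    · push_cast
      field_simp
      ring

theorem hasSum_completeHarmonic (k : ℕ) :
    HasSum (fun n : ℕ => (completeHarmonic k (n + 1) : ℝ) / ((n : ℝ) + 1) ^ 2)
      (((k : ℝ) + 1) * realZeta (k + 2)) := by
  refine hasSum_swap_of_nonneg (F := fun m n => betaCoeff k m (n + 1) / ((n : ℝ) + 1)) ?_
    (hasSum_betaCoeff_div k) (fun n => ?_) ?_
  · intro m n
    exact div_nonneg (betaCoeff_nonneg _ _ _) (by positivity)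
  · have h1 : (completeHarmonic k (n + 1) : ℝ) / ((n : ℝ) + 1) ^ 2 =
        betaCoeff k 0 n / ((n : ℝ) + 1) := by
      rw [betaCoeff_first]; field_simp
    rw [h1]
    apply HasSum.div_const
    exact hasSum_of_telescoping (g := fun m => betaCoeff k m n) (fun m => betaCoeff_nonneg k _ _)
      (fun m => by rw [betaCoeff_eq_add k m n]; ring) (tendsto_betaCoeff_left k n)
  · exact hasSum_of_eq ((hasSum_realZeta (s := k + 2) (by omega)).mul_left ((k : ℝ) + 1))
      (fun n => (mul_one_div _ _).symm) rfl


/-! ### Connected sums and duality -/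

/-- The reciprocal binomial coefficient `n! m! / (n + m)!`. -/
noncomputable def connector (n m : ℕ) : ℝ :=
  (n.factorial : ℝ) * m.factorial / (n + m).factorial

theorem connector_nonneg (n m : ℕ) : 0 ≤ connector n m := by unfold connector; positivity

theorem connector_comm (n m : ℕ) : connector n m = connector m n := by
  unfold connector
  rw [add_comm n m, mul_comm]

theorem connector_zero_left (m : ℕ) : connector 0 m = 1 := by
  unfold connector
  have : (m.factorial : ℝ) ≠ 0 := by positivity
  simp [this]

theorem connector_succ_left (n m : ℕ) :
    connector (n + 1) m * ((n : ℝ) + 1 + m) = connector n m * ((n : ℝ) + 1) := by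
  unfold connector
  rw [show n + 1 + m = n + m + 1 by ring, Nat.factorial_succ, Nat.factorial_succ]
  have : ((n + m).factorial : ℝ) ≠ 0 := by positivity
  have h2 : (n : ℝ) + m + 1 ≠ 0 := by positivity
  push_cast
  field_simp
  ring

/-- The transport relation: summed over `n`, it trades a factor `1/(n + 1)` for `1/(m + 1)`. -/
theorem connector_succ_left_div (n m : ℕ) : connector (n + 1) (m + 1) / ((n : ℝ) + 1) =
    connector n (m + 1) / ((m : ℝ) + 1) - connector (n + 1) (m + 1) / ((m : ℝ) + 1) := by
  have h := connector_succ_left n (m + 1)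
  have h1 : (n : ℝ) + 1 ≠ 0 := by positivity
  have h2 : (m : ℝ) + 1 ≠ 0 := by positivity
  push_cast at h
  field_simp
  linarith

theorem connector_succ_le (n m : ℕ) : connector n (m + 1) ≤ connector n m := by
  rw [connector_comm n, connector_comm n]
  have h := connector_succ_left m n
  have h0 := connector_nonneg (m + 1) n
  have h1 : (0 : ℝ) ≤ n := by positivity
  have h2 : (0 : ℝ) < (m : ℝ) + 1 := by positivity
  have h3 := mul_nonneg h0 h1
  refine le_of_mul_le_mul_right (a := (m : ℝ) + 1) ?_ h2
  linarith

theorem tendsto_connector (m : ℕ) : Tendsto (fun n => connector n (m + 1)) atTop (𝓝 0) := by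
  induction m with
  | zero =>
    refine (tendsto_one_div_add_atTop_nhds_zero_nat (𝕜 := ℝ)).congr fun n => ?_
    unfold connector
    rw [zero_add, Nat.factorial_succ n]
    have : (n.factorial : ℝ) ≠ 0 := by positivity
    push_cast
    field_simp
    simp
  | succ m ih =>
    exact squeeze_zero (fun n => connector_nonneg _ _) (fun n => connector_succ_le n (m + 1)) ih

theorem hasSum_connector_div (n m : ℕ) :
    HasSum (fun c : ℕ => connector (n + c + 1) (m + 1) / (((n + c : ℕ) : ℝ) + 1))
      (connector n (m + 1) / ((m : ℝ) + 1)) := by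
  refine hasSum_of_telescoping (g := fun c => connector (n + c) (m + 1) / ((m : ℝ) + 1))
    (fun c => div_nonneg (connector_nonneg _ _) (by positivity))
    (fun c => connector_succ_left_div (n + c) m) ?_
  have h := ((tendsto_connector m).comp (tendsto_add_atTop_nat n)).div_const ((m : ℝ) + 1)
  rw [zero_div] at h
  refine h.congr fun c => ?_
  simp only [Function.comp]
  rw [add_comm c n]

theorem elemHarmonic_succ_eq_sum (k n : ℕ) :
    (elemHarmonic (k + 1) n : ℝ) = ∑ b ∈ range n, (elemHarmonic k b : ℝ) / ((b : ℝ) + 1) := by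
  induction n with
  | zero => simp [elemHarmonic_succ_zero]
  | succ n ih =>
    rw [sum_range_succ, ← ih, elemHarmonic_succ_succ]
    push_cast
    ring

theorem elemHarmonic_nonneg (k n : ℕ) : (0 : ℝ) ≤ elemHarmonic k n := by
  induction k generalizing n with
  | zero => simp [elemHarmonic_zero_left]
  | succ k ih =>
    rw [elemHarmonic_succ_eq_sum]
    exact sum_nonneg fun b _ => div_nonneg (ih b) (by positivity)

/-- `elemHarmonic j` is a `j`-fold nested sum; summing the outermost index first transports one
factor `1/(m + 1)` per level. -/
theorem hasSum_elemHarmonic_mul_connector (j m : ℕ) :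
    HasSum (fun n : ℕ => (elemHarmonic j n : ℝ) / ((n : ℝ) + 1) * connector (n + 1) (m + 1))
      (1 / ((m : ℝ) + 1) ^ (j + 1)) := by
  induction j with
  | zero =>
    refine hasSum_of_eq (hasSum_connector_div 0 m) (fun n => ?_) ?_
    · rw [elemHarmonic_zero_left, zero_add]
      push_cast
      ring
    · rw [connector_zero_left, zero_add, pow_one]
  | succ j ih =>
    have h := hasSum_sum_range_of_nonneg
      (f := fun a b => (elemHarmonic j b : ℝ) / ((b : ℝ) + 1) *
        (connector (a + 1) (m + 1) / ((a : ℝ) + 1)))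
      (fun a b => mul_nonneg (div_nonneg (elemHarmonic_nonneg _ _) (by positivity))
        (div_nonneg (connector_nonneg _ _) (by positivity)))
      (fun b => (hasSum_connector_div (b + 1) m).mul_left _)
      (hasSum_of_eq (ih.div_const ((m : ℝ) + 1)) (fun b => by ring) rfl)
    refine hasSum_of_eq h (fun n => ?_) ?_
    · rw [← sum_mul, ← elemHarmonic_succ_eq_sum]
      ring
    · rw [div_div, ← pow_succ]

theorem hasSum_elemHarmonic_dual (j : ℕ) {w v : ℕ → ℝ} {A : ℝ} (hw : ∀ m, 0 ≤ w m)
    (hv : ∀ n, HasSum (fun m => w m * connector (m + 1) (n + 1)) (v n))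
    (hA : HasSum (fun m : ℕ => w m / ((m : ℝ) + 1) ^ (j + 1)) A) :
    HasSum (fun n : ℕ => (elemHarmonic j n : ℝ) / ((n : ℝ) + 1) * v n) A := by
  refine hasSum_swap_of_nonneg (F := fun m n => w m *
    ((elemHarmonic j n : ℝ) / ((n : ℝ) + 1) * connector (n + 1) (m + 1))) ?_
    (fun m => (hasSum_elemHarmonic_mul_connector j m).mul_left (w m)) (fun n => ?_) ?_
  · intro m n
    exact mul_nonneg (hw m) (mul_nonneg (div_nonneg (elemHarmonic_nonneg _ _) (by positivity))
      (connector_nonneg _ _))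
  · refine hasSum_of_eq ((hv n).mul_left _) (fun m => ?_) rfl
    rw [connector_comm]
    ring
  · exact hasSum_of_eq hA (fun m => mul_one_div _ _) rfl

theorem hasSum_elemHarmonic_div_sq (k : ℕ) :
    HasSum (fun n : ℕ => (elemHarmonic k n : ℝ) / ((n : ℝ) + 1) ^ 2) (realZeta (k + 2)) := by
  refine hasSum_of_eq (hasSum_elemHarmonic_dual k (w := fun m => 1 / ((m : ℝ) + 1))
    (fun m => by positivity)
    (fun n => hasSum_of_eq (hasSum_elemHarmonic_mul_connector 0 n) (fun m => ?_) rfl)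
    (hasSum_of_eq (hasSum_realZeta (s := k + 2) (by omega)) (fun m => ?_) rfl)) (fun n => ?_) rfl
  · rw [elemHarmonic_zero_left, Rat.cast_one]
  · rw [div_div, ← pow_succ']
  · rw [zero_add, pow_one, pow_two, div_mul_div_comm, mul_one]

/-- The duality `ζ(3,1,…,1) = ζ(j+2,1)`, with `j` ones on the left. -/
theorem hasSum_elemHarmonic_div_cube (j : ℕ) {A : ℝ}
    (hA : HasSum (fun m : ℕ => (elemHarmonic 1 m : ℝ) / ((m : ℝ) + 1) ^ (j + 2)) A) :
    HasSum (fun n : ℕ => (elemHarmonic j n : ℝ) / ((n : ℝ) + 1) ^ 3) A := by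
  refine hasSum_of_eq (hasSum_elemHarmonic_dual j
    (w := fun m => (elemHarmonic 1 m : ℝ) / ((m : ℝ) + 1))
    (fun m => div_nonneg (elemHarmonic_nonneg _ _) (by positivity))
    (fun n => hasSum_elemHarmonic_mul_connector 1 n)
    (hasSum_of_eq hA (fun m => ?_) rfl)) (fun n => ?_) rfl
  · rw [div_div, ← pow_succ']
  · rw [div_mul_div_comm, mul_one, ← pow_succ']


/-! ### Euler's evaluation of `ζ(p+2,1)` -/

/-- The generalized harmonic number `∑_{b = 1}^n 1 / b^l` as a real number. -/
noncomputable def powerHarmonic (l n : ℕ) : ℝ := ∑ b ∈ range n, 1 / ((b : ℝ) + 1) ^ l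

theorem powerHarmonic_nonneg (l n : ℕ) : 0 ≤ powerHarmonic l n :=
  sum_nonneg fun b _ => by positivity

theorem powerHarmonic_one (n : ℕ) : powerHarmonic 1 n = elemHarmonic 1 n := by
  rw [elemHarmonic_succ_eq_sum]
  simp [powerHarmonic, elemHarmonic_zero_left]

theorem summable_powerHarmonic_one {j : ℕ} (hj : 2 ≤ j) :
    Summable (fun n : ℕ => powerHarmonic 1 n / ((n : ℝ) + 1) ^ j) := by
  refine Summable.of_nonneg_of_le (fun n => div_nonneg (powerHarmonic_nonneg _ _) (by positivity))
    (fun n => ?_) (hasSum_elemHarmonic_div_sq 1).summable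
  rw [powerHarmonic_one]
  apply div_le_div_of_nonneg_left (elemHarmonic_nonneg _ _) (by positivity)
  exact pow_le_pow_right₀ (by linarith [Nat.cast_nonneg (α := ℝ) n]) hj

theorem hasSum_stuffle {j l : ℕ} (hj : 2 ≤ j) (hl : 2 ≤ l) :
    HasSum (fun n : ℕ => powerHarmonic l n / ((n : ℝ) + 1) ^ j +
      powerHarmonic j n / ((n : ℝ) + 1) ^ l + 1 / ((n : ℝ) + 1) ^ (j + l))
      (realZeta j * realZeta l) := by
  rw [hasSum_iff_tendsto_nat_of_nonneg]
  -- The identity is exact for partial sums: a square splits into two triangles and the diagonal.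
  · refine ((hasSum_realZeta hj).tendsto_sum_nat.mul (hasSum_realZeta hl).tendsto_sum_nat).congr
      fun N => ?_
    induction N with
    | zero => simp
    | succ N ih =>
      simp only [sum_range_succ _ N]
      rw [← ih]
      unfold powerHarmonic
      rw [pow_add]
      ring
  · intro n
    have := powerHarmonic_nonneg l n
    have := powerHarmonic_nonneg j n
    positivity

theorem hasSum_one_div_mul_add (B : ℕ) :
    HasSum (fun c : ℕ => 1 / (((c : ℝ) + 1) * ((c : ℝ) + 1 + (B + 1))))
      (powerHarmonic 1 (B + 1) / ((B : ℝ) + 1)) := by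
  have hB : (B : ℝ) + 1 ≠ 0 := by positivity
  have h := hasSum_of_telescoping
    (f := fun c : ℕ => 1 / (((c : ℝ) + 1) * ((c : ℝ) + 1 + (B + 1))))
    -- A sliding window of `B + 1` reciprocals: moving it by one leaves only the end terms.
    (g := fun c : ℕ => (∑ i ∈ range (B + 1), 1 / (((c + i : ℕ) : ℝ) + 1)) / ((B : ℝ) + 1))
    (fun c => by positivity) (fun c => ?_) ?_
  · refine hasSum_of_eq h (fun _ => rfl) ?_
    unfold powerHarmonic
    congr 1
    exact sum_congr rfl fun i _ => by rw [zero_add, pow_one]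
  · have h1 := sum_range_succ (fun i : ℕ => 1 / (((c + i : ℕ) : ℝ) + 1)) (B + 1)
    rw [sum_range_succ'] at h1
    have h2 : ∑ i ∈ range (B + 1), 1 / (((c + (i + 1) : ℕ) : ℝ) + 1) =
        ∑ i ∈ range (B + 1), 1 / (((c + 1 + i : ℕ) : ℝ) + 1) :=
      sum_congr rfl fun i _ => by rw [show c + (i + 1) = c + 1 + i by ring]
    rw [h2, show c + (B + 1) = c + 1 + B by ring] at h1
    have h3 : ∑ i ∈ range (B + 1), 1 / (((c + i : ℕ) : ℝ) + 1) -
        ∑ i ∈ range (B + 1), 1 / (((c + 1 + i : ℕ) : ℝ) + 1) =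
        1 / ((c : ℝ) + 1) - 1 / ((c : ℝ) + 1 + (B + 1)) := by
      have h4 : (((c + 1 + B : ℕ) : ℝ) + 1) = (c : ℝ) + 1 + (B + 1) := by push_cast; ring
      rw [h4, add_zero] at h1
      linarith
    rw [← sub_div, h3]
    have h5 : (c : ℝ) + 1 ≠ 0 := by positivity
    have h6 : (c : ℝ) + 1 + (B + 1) ≠ 0 := by positivity
    field_simp
    ring
  · have h := (tendsto_finsetSum (range (B + 1)) fun i _ =>
      (tendsto_one_div_add_atTop_nhds_zero_nat (𝕜 := ℝ)).comp (tendsto_add_atTop_nat i)).div_const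
      ((B : ℝ) + 1)
    simpa [Function.comp_def] using h

/-- With `A = B + C`, iterate `1/(B C) = (1/A)(1/B + 1/C)`. -/
theorem geometric_partial_fraction (p b c : ℕ) :
    (1 / ((b : ℝ) + 1)) ^ (p + 1) * (1 / (((c : ℝ) + 1) * ((c : ℝ) + 1 + (b + 1)))) =
      ∑ i ∈ range (p + 1),
        (1 / (((b + 1 + c : ℕ) : ℝ) + 1)) ^ (i + 2) * (1 / ((b : ℝ) + 1)) ^ (p + 1 - i) +
      (1 / (((b + 1 + c : ℕ) : ℝ) + 1)) ^ (p + 2) * (1 / ((c : ℝ) + 1)) := by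
  have hb : (b : ℝ) + 1 ≠ 0 := by positivity
  have hc : (c : ℝ) + 1 ≠ 0 := by positivity
  have ha : (c : ℝ) + 1 + (b + 1) ≠ 0 := by positivity
  have h1 : (((b + 1 + c : ℕ) : ℝ) + 1) = (c : ℝ) + 1 + (b + 1) := by push_cast; ring
  rw [h1]
  induction p with
  | zero =>
    simp
    field_simp
  | succ p ih =>
    rw [sum_range_succ]
    have h2 : ∑ i ∈ range (p + 1),
        (1 / ((c : ℝ) + 1 + (b + 1))) ^ (i + 2) * (1 / ((b : ℝ) + 1)) ^ (p + 1 + 1 - i) =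
        (1 / ((b : ℝ) + 1)) * ∑ i ∈ range (p + 1),
        (1 / ((c : ℝ) + 1 + (b + 1))) ^ (i + 2) * (1 / ((b : ℝ) + 1)) ^ (p + 1 - i) := by
      rw [mul_sum]
      refine sum_congr rfl fun i hi => ?_
      rw [mem_range] at hi
      rw [show p + 1 + 1 - i = p + 1 - i + 1 by omega, pow_succ (1 / ((b : ℝ) + 1))]
      ring
    rw [h2, pow_succ _ (p + 1), show p + 1 + 1 - (p + 1) = 1 by omega]
    have h3 : 1 / ((b : ℝ) + 1) * (1 / ((c : ℝ) + 1)) =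
        1 / ((c : ℝ) + 1 + (b + 1)) * (1 / ((b : ℝ) + 1) + 1 / ((c : ℝ) + 1)) := by
      field_simp
    rw [show p + 1 + 2 = p + 2 + 1 by ring, pow_succ _ (p + 2)]
    linear_combination (1 / ((b : ℝ) + 1)) * ih + (1 / ((c : ℝ) + 1 + (b + 1))) ^ (p + 2) * h3

/-- Sum `1/(B^(p+1) (A - B) A)` over `B < A` in two ways. Summing over `A` first gives `E + ζ(p+3)`;
partial fractions give the depth-two sums plus `E`. The Euler sum `E` converges and cancels. -/
theorem hasSum_depth_two (p : ℕ) :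
    HasSum (fun n : ℕ => ∑ i ∈ range (p + 1), powerHarmonic (p + 1 - i) n / ((n : ℝ) + 1) ^ (i + 2))
      (realZeta (p + 3)) := by
  have hE := (summable_powerHarmonic_one (j := p + 2) (by omega)).hasSum
  set E := ∑' n : ℕ, powerHarmonic 1 n / ((n : ℝ) + 1) ^ (p + 2)
  have hg : HasSum (fun b : ℕ => (1 / ((b : ℝ) + 1)) ^ (p + 1) *
      (powerHarmonic 1 (b + 1) / ((b : ℝ) + 1))) (E + realZeta (p + 3)) := by
    refine hasSum_of_eq (hE.add (hasSum_realZeta (s := p + 3) (by omega))) (fun b => ?_) rfl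
    have : powerHarmonic 1 (b + 1) = powerHarmonic 1 b + 1 / ((b : ℝ) + 1) := by
      unfold powerHarmonic
      rw [sum_range_succ, pow_one]
    rw [this]
    have hb : (b : ℝ) + 1 ≠ 0 := by positivity
    rw [one_div_pow]
    field_simp
    ring
  have h := hasSum_sum_range_of_nonneg
    (f := fun a b => (1 / ((b : ℝ) + 1)) ^ (p + 1) *
      (1 / (((a - b : ℕ) : ℝ) * ((a : ℝ) + 1))))
    (fun a b => by positivity)
    (fun b => hasSum_of_eq ((hasSum_one_div_mul_add b).mul_left _) (fun c => by
      rw [show b + 1 + c - b = c + 1 by omega]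
      push_cast
      congr 3
      ring) rfl) hg
  refine hasSum_of_eq (h.sub hE) (fun a => ?_) (by ring)
  have h1 : ∀ b ∈ range a, (1 / ((b : ℝ) + 1)) ^ (p + 1) *
      (1 / (((a - b : ℕ) : ℝ) * ((a : ℝ) + 1))) =
      ∑ i ∈ range (p + 1),
        (1 / ((a : ℝ) + 1)) ^ (i + 2) * (1 / ((b : ℝ) + 1)) ^ (p + 1 - i) +
      (1 / ((a : ℝ) + 1)) ^ (p + 2) * (1 / ((a - b : ℕ) : ℝ)) := by
    intro b hb
    rw [mem_range] at hb
    obtain ⟨c, rfl⟩ := Nat.exists_eq_add_of_lt hb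
    have := geometric_partial_fraction p b c
    rw [show b + c + 1 - b = c + 1 by omega, show b + c + 1 = b + 1 + c by omega, Nat.cast_succ,
      ← this]
    push_cast
    congr 3
    ring
  have h2 : ∑ b ∈ range a, 1 / ((a - b : ℕ) : ℝ) = powerHarmonic 1 a := by
    unfold powerHarmonic
    rw [← sum_range_reflect]
    refine sum_congr rfl fun b hb => ?_
    rw [mem_range] at hb
    rw [pow_one, ← Nat.cast_succ]
    congr 2
    omega
  rw [sum_congr rfl h1, sum_add_distrib, sum_comm, ← mul_sum, h2]
  rw [one_div_pow, one_div_mul_eq_div, add_sub_cancel_right]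
  refine sum_congr rfl fun i _ => ?_
  rw [← mul_sum, one_div_pow, one_div_mul_eq_div]
  unfold powerHarmonic
  simp only [one_div_pow]

/-- The term `i = p` of the sum formula is the one sought. By the symmetry `i ↦ p - 1 - i`, the
stuffle products count each remaining term twice, plus `p` copies of `ζ(p+3)`. -/
theorem hasSum_powerHarmonic_one (p : ℕ) :
    HasSum (fun n : ℕ => powerHarmonic 1 n / ((n : ℝ) + 1) ^ (p + 2))
      (((p : ℝ) + 2) / 2 * realZeta (p + 3) -
        1 / 2 * ∑ i ∈ range p, realZeta (i + 2) * realZeta (p + 1 - i)) := by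
  have hp : HasSum (fun n : ℕ => ∑ i ∈ range p, (powerHarmonic (p + 1 - i) n / ((n : ℝ) + 1) ^ (i + 2)
      + powerHarmonic (i + 2) n / ((n : ℝ) + 1) ^ (p + 1 - i)
      + 1 / ((n : ℝ) + 1) ^ (i + 2 + (p + 1 - i))))
      (∑ i ∈ range p, realZeta (i + 2) * realZeta (p + 1 - i)) :=
    hasSum_sum fun i hi => hasSum_stuffle (by omega) (by rw [mem_range] at hi; omega)
  refine hasSum_of_eq ((hasSum_depth_two p).sub ((hp.sub ((hasSum_realZeta (s := p + 3)
    (by omega)).mul_left (p : ℝ))).mul_left (1 / 2))) (fun n => ?_) (by ring)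
  rw [sum_range_succ, sum_add_distrib, sum_add_distrib]
  have h1 : ∑ i ∈ range p, powerHarmonic (i + 2) n / ((n : ℝ) + 1) ^ (p + 1 - i) =
      ∑ i ∈ range p, powerHarmonic (p + 1 - i) n / ((n : ℝ) + 1) ^ (i + 2) := by
    rw [← sum_range_reflect]
    refine sum_congr rfl fun i hi => ?_
    rw [mem_range] at hi
    rw [show p - 1 - i + 2 = p + 1 - i by omega, show p + 1 - (p - 1 - i) = i + 2 by omega]
  have h2 : ∑ i ∈ range p, 1 / ((n : ℝ) + 1) ^ (i + 2 + (p + 1 - i)) =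
      p * (1 / ((n : ℝ) + 1) ^ (p + 3)) := by
    rw [sum_congr rfl (g := fun _ => 1 / ((n : ℝ) + 1) ^ (p + 3)), sum_const, card_range, nsmul_eq_mul]
    intro i hi
    rw [mem_range] at hi
    rw [show i + 2 + (p + 1 - i) = p + 3 by omega]
  rw [h1, h2, show p + 1 - p = 1 by omega]
  ring

theorem hasSum_elemHarmonic (p : ℕ) :
    HasSum (fun n : ℕ => (elemHarmonic (p + 1) (n + 1) : ℝ) / ((n : ℝ) + 1) ^ 2)
      (((p : ℝ) + 4) / 2 * realZeta (p + 3) -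
        1 / 2 * ∑ i ∈ range p, realZeta (i + 2) * realZeta (p + 1 - i)) := by
  have hA := hasSum_powerHarmonic_one p
  simp only [powerHarmonic_one] at hA
  refine hasSum_of_eq ((hasSum_elemHarmonic_div_sq (p + 1)).add (hasSum_elemHarmonic_div_cube p hA))
    (fun n => ?_) (by ring)
  rw [elemHarmonic_succ_succ]
  have hn : (n : ℝ) + 1 ≠ 0 := by positivity
  push_cast
  field_simp

/-! ### Transfer to the complex zeta function -/

theorem theorem3 (k : ℕ) :
    HasSum (fun n : ℕ => (completeHarmonic k (n + 1) : ℂ) / ((n : ℂ) + 1) ^ 2)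
      (((k : ℂ) + 1) * riemannZeta ((k : ℂ) + 2)) ∧
    (1 ≤ k →
      HasSum (fun n : ℕ => (elemHarmonic k (n + 1) : ℂ) / ((n : ℂ) + 1) ^ 2)
        (((k : ℂ) + 3) / 2 * riemannZeta ((k : ℂ) + 2) -
          1 / 2 * ∑ j ∈ Finset.Icc 2 k,
            riemannZeta (j : ℂ) * riemannZeta ((k : ℂ) + 2 - (j : ℂ)))) := by
  have hz : riemannZeta ((k : ℂ) + 2) = (realZeta (k + 2) : ℂ) := by
    rw [← riemannZeta_eq_realZeta (by omega)]
    push_cast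
    rfl
  constructor
  · have h := Complex.hasSum_ofReal.2 (hasSum_completeHarmonic k)
    push_cast at h
    rw [hz]
    exact h
  · intro hk
    obtain ⟨p, rfl⟩ := Nat.exists_eq_add_of_le' hk
    have h := Complex.hasSum_ofReal.2 (hasSum_elemHarmonic p)
    push_cast at h
    have hs : ∑ j ∈ Finset.Icc 2 (p + 1),
        riemannZeta (j : ℂ) * riemannZeta (((p + 1 : ℕ) : ℂ) + 2 - (j : ℂ)) =
        ∑ i ∈ range p, (realZeta (i + 2) : ℂ) * (realZeta (p + 1 - i) : ℂ) := by
      have h2 := Finset.sum_Ico_add' (fun j : ℕ => riemannZeta (j : ℂ) *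
        riemannZeta (((p + 1 : ℕ) : ℂ) + 2 - (j : ℂ))) 0 p 2
      rw [zero_add, show p + 2 = p + 1 + 1 by ring, Finset.Ico_add_one_right_eq_Icc] at h2
      rw [← h2, Finset.range_eq_Ico]
      refine sum_congr rfl fun i hi => ?_
      rw [mem_Ico] at hi
      rw [← riemannZeta_eq_realZeta (by omega), ← riemannZeta_eq_realZeta (by omega)]
      congr 2
      rw [Nat.cast_sub (by omega)]
      push_cast
      ring
    rw [hz, hs]
    convert h using 3
    push_cast
    ring
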